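/- Let $(A,\mathfrak m)$ be a regular local ring and let $I \subsetneq A$ be a proper ideal. Let $m=\mu(I)$ be the minimal number of generators of $I$, let $g=\operatorname{grade}(I)$ be the supremum of the lengths of $A$-regular sequences contained in $I$, and let $\mathbf u=u_1,\dots,u_m$ be a minimal system of generators of $I$. Write $H_i(I)=H_i(\mathbf u)$ for the $i$-th homology module of the Koszul complex of $\mathbf u$ over $A$ (up to isomorphism it does not depend on the choice of $\mathbf u$). For a nonzero finitely generated $A$-module $E$ let $\operatorname{cmd}E=\dim E-\operatorname{depth}E$ be its Cohen–Macaulay defect. Set $$c=\max\{\operatorname{cmd}H_i(I) : 0\le i<m-g\},$$ with $c=0$ if $m=g$. Then $$\operatorname{cmd}H_{m-g}(I)\le\max\{0,\,c-2\}.$$ -/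

import Mathlib

noncomputable section

namespace Koszul

variable {A : Type*} [CommRing A] {m : ℕ}

/-- The degree `i` term `⋀ⁱ Aᵐ` of the Koszul complex of a sequence of length `m`: the free module
with basis `e_S`, where `S` runs over the `i`-element subsets of `{0, …, m - 1}` and
`e_S = e_{j₁} ∧ ⋯ ∧ e_{jᵢ}` for `S = {j₁ < ⋯ < jᵢ}`. An element is given by its coordinates. -/
abbrev Chain (A : Type*) (m i : ℕ) : Type _ := {S : Finset (Fin m) // S.card = i} → A

/-- The sign `(-1) ^ #{k ∈ T | k < j}`. -/
def sign (A : Type*) [CommRing A] (j : Fin m) (T : Finset (Fin m)) : A :=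
  (-1) ^ (T.filter (· < j)).card

/-- The Koszul differential `⋀ⁱ⁺¹ Aᵐ → ⋀ⁱ Aᵐ` of the sequence `u`, that is
`e_S ↦ ∑ j ∈ S, (-1) ^ #{k ∈ S | k < j} * u j • e_{S \ {j}}`, written in coordinates
(the coefficient of `e_T` receives a contribution from every `S = T ∪ {j}` with `j ∉ T`). -/
def d (u : Fin m → A) (i : ℕ) : Chain A m (i + 1) →ₗ[A] Chain A m i where
  toFun f T := ∑ j : {j : Fin m // j ∉ T.1}, sign A j.1 T.1 * u j *
    f ⟨insert j.1 T.1, by rw [Finset.card_insert_of_notMem j.2, T.2]⟩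
  map_add' f f' := by
    funext T
    simp [mul_add, Finset.sum_add_distrib]
  map_smul' a f := by
    funext T
    simp only [Pi.smul_apply, smul_eq_mul, RingHom.id_apply, Finset.mul_sum]
    exact Finset.sum_congr rfl fun j _ => by ring

theorem sign_insert {j k : Fin m} {T : Finset (Fin m)} (hj : j ∉ T) (hk : k ∉ T) (hjk : j ≠ k) :
    sign A j T * sign A k (insert j T) + sign A k T * sign A j (insert k T) = 0 := by
  have key : ∀ {a b : Fin m}, a ∉ T → b ∉ T → a < b →
      sign A a T * sign A b (insert a T) + sign A b T * sign A a (insert b T) = 0 := by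
    intro a b ha hb hab
    unfold Koszul.sign
    rw [Finset.filter_insert, Finset.filter_insert, if_pos hab, if_neg (not_lt.2 hab.le),
      Finset.card_insert_of_notMem (fun h => ha (Finset.mem_filter.1 h).1)]
    ring
  rcases lt_or_gt_of_ne hjk with h | h
  · exact key hj hk h
  · rw [add_comm]
    exact key hk hj h

theorem d_d (u : Fin m → A) (i : ℕ) (f : Chain A m (i + 2)) : d u i (d u (i + 1) f) = 0 := by
  funext T
  change ∑ j : {j : Fin m // j ∉ T.1}, sign A j.1 T.1 * u j *
    ∑ k : {k : Fin m // k ∉ insert j.1 T.1}, sign A k.1 (insert j.1 T.1) * u k *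
      f ⟨insert k.1 (insert j.1 T.1), _⟩ = 0
  simp_rw [Finset.mul_sum]
  rw [Finset.sum_sigma']
  refine Finset.sum_involution
    (fun x _ => ⟨⟨x.2.1, fun h => x.2.2 (Finset.mem_insert_of_mem h)⟩,
      ⟨x.1.1, fun h => (Finset.mem_insert.1 h).elim
        (fun h => x.2.2 (Finset.mem_insert.2 (Or.inl h.symm))) x.1.2⟩⟩) ?_ ?_ ?_ ?_
  · rintro ⟨⟨j, hj⟩, ⟨k, hk⟩⟩ -
    have hkT : k ∉ T.1 := fun h => hk (Finset.mem_insert_of_mem h)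
    have hjk : j ≠ k := fun h => hk (Finset.mem_insert.2 (Or.inl h.symm))
    have hs := sign_insert (A := A) hj hkT hjk
    have hf : ∀ (S S' : {S : Finset (Fin m) // S.card = i + 2}), S.1 = S'.1 → f S = f S' :=
      fun S S' h => congrArg f (Subtype.ext h)
    have he := hf ⟨insert k (insert j T.1), by
        rw [Finset.card_insert_of_notMem hk, Finset.card_insert_of_notMem hj, T.2]⟩
      ⟨insert j (insert k T.1), by
        rw [Finset.insert_comm, Finset.card_insert_of_notMem hk, Finset.card_insert_of_notMem hj,
          T.2]⟩ (Finset.insert_comm k j T.1)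
    dsimp only
    rw [← he]
    linear_combination (u j * u k * f ⟨insert k (insert j T.1), by
      rw [Finset.card_insert_of_notMem hk, Finset.card_insert_of_notMem hj, T.2]⟩) * hs
  · rintro ⟨⟨j, hj⟩, ⟨k, hk⟩⟩ - - h
    have : k = j := congrArg (fun x => x.1.1) h
    exact hk (Finset.mem_insert.2 (Or.inl this))
  · intros
    exact Finset.mem_univ _
  · intros
    rfl

/-- The `i`-cycles of the Koszul complex of `u`; every `0`-chain is a cycle. -/
def cycles (u : Fin m → A) : (i : ℕ) → Submodule A (Chain A m i)
  | 0 => ⊤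
  | i + 1 => LinearMap.ker (d u i)

/-- The `i`-boundaries of the Koszul complex of `u`. -/
def boundaries (u : Fin m → A) (i : ℕ) : Submodule A (Chain A m i) := LinearMap.range (d u i)

theorem boundaries_le_cycles (u : Fin m → A) (i : ℕ) : boundaries u i ≤ cycles u i := by
  cases i with
  | zero => exact le_top
  | succ i =>
    rintro _ ⟨f, rfl⟩
    exact d_d u i f

/-- The Koszul homology module `H_i(u) = H_i(u, A)`. -/
abbrev H (u : Fin m → A) (i : ℕ) : Type _ :=
  cycles u i ⧸ (boundaries u i).submoduleOf (cycles u i)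

end Koszul

/-- `grade(I, E)`: the supremum of the lengths of the `E`-regular sequences contained in `I`. -/
def idealGrade {A : Type*} [CommRing A] (I : Ideal A) (E : Type*) [AddCommGroup E] [Module A E] : ℕ∞ :=
  ⨆ (rs : List A) (_ : RingTheory.Sequence.IsRegular E rs ∧ ∀ r ∈ rs, r ∈ I), (rs.length : ℕ∞)

/-- The depth of a module over a local ring. -/
def depth (A : Type*) [CommRing A] [IsLocalRing A] (E : Type*) [AddCommGroup E] [Module A E] :
    ℕ∞ :=
  idealGrade (IsLocalRing.maximalIdeal A) E

/-- The Cohen–Macaulay defect `cmd E = dim E - depth E`. For a nonzero finitely generated module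
over a Noetherian local ring both numbers are finite, so that the casts lose nothing.
(For `E = 0` the value is `0`.) -/
def cmd (A : Type*) [CommRing A] [IsLocalRing A] (E : Type*) [AddCommGroup E] [Module A E] : ℤ :=
  (((Module.supportDim A E).unbotD 0).toNat : ℤ) - ((depth A E).toNat : ℤ)

end

/-! Let `n = dim A`, let `rs` be a maximal regular sequence in `I` (length `g`), and put `s = n -
g`. Regularity of `A` enters only through an `A`-regular sequence of length `n` in the maximal
ideal.

All `H_i` with `i ≤ m - g` have dimension `s`. Since `I` kills `H_i` and contains `rs`, the
dimension is at most `dim A/(rs) = s`. Conversely, maximality of `rs` and prime avoidance give an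
associated prime `p ⊇ I` of `A/(rs)`. As `A/(rs)` has depth at least `s`, `dim A/p ≥ s`. Moreover
`H_{m-g}` is nonzero at `p`, and by rigidity so are all lower `H_i`. Hence defects and depths
determine each other: `depth H_i ≥ s - c` for `i < m - g`.

The rest is a depth count on `0 → B_i → Z_i → H_i → 0` and `0 → Z_{i+1} → K_{i+1} → B_i → 0`.
Climbing from `Z_0 = K_0`, a bound `e` on the depths of the lower homology gains one in each
sequence, so `depth Z_{m-g} ≥ min(n, e + 2)`. Descending from degree `m`, where the complex is exact
above degree `m - g`, gives depth at least `s + 1` for `B_{m-g}` (or `B_{m-g} = 0`). So `depth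
H_{m-g} ≥ min(s, e + 2)`, which is the claim with `e = max(0, s - c)`. -/

noncomputable section

namespace Koszul

/-! ### The Koszul complex on chains of all degrees -/

section TotalComplex

variable {A : Type*} [CommRing A] {m : ℕ} {M : Type*} [AddCommGroup M] [Module A M]

theorem sign_mul_self (j : Fin m) (T : Finset (Fin m)) : sign A j T * sign A j T = 1 := by
  unfold sign
  rw [← pow_add, ← two_mul, pow_mul]
  simp

/-- The differential of the Koszul complex of `u` with coefficients in `M`, on chains of all
degrees at once. -/
def diff (u : Fin m → A) : (Finset (Fin m) → M) →ₗ[A] (Finset (Fin m) → M) where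
  toFun f T := ∑ j ∈ Tᶜ, (sign A j T * u j) • f (insert j T)
  map_add' f f' := by
    funext T
    simp [Finset.sum_add_distrib]
  map_smul' a f := by
    funext T
    simp only [Pi.smul_apply, RingHom.id_apply, Finset.smul_sum]
    exact Finset.sum_congr rfl fun j _ => smul_comm _ _ _

theorem diff_apply (u : Fin m → A) (f : Finset (Fin m) → M) (T : Finset (Fin m)) :
    diff u f T = ∑ j ∈ Tᶜ, (sign A j T * u j) • f (insert j T) := rfl

theorem diff_diff (u : Fin m → A) (f : Finset (Fin m) → M) : diff u (diff u f) = 0 := by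
  funext T
  simp only [diff_apply, Finset.smul_sum, Pi.zero_apply]
  rw [Finset.sum_sigma']
  refine Finset.sum_involution (fun x _ => ⟨x.2, x.1⟩) ?_ ?_ ?_ ?_
  · rintro ⟨j, k⟩ h
    simp only [Finset.mem_sigma, Finset.mem_compl, Finset.mem_insert, not_or] at h
    have hs := sign_insert (A := A) h.1 h.2.2 (Ne.symm h.2.1)
    dsimp only
    rw [Finset.insert_comm j k, smul_smul, smul_smul, ← add_smul]
    convert zero_smul A _
    linear_combination (u j * u k) * hs
  · rintro ⟨j, k⟩ h - h'
    simp only [Finset.mem_sigma, Finset.mem_compl, Finset.mem_insert, not_or] at h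
    exact h.2.1 (congrArg Sigma.fst h')
  · rintro ⟨j, k⟩ h
    simp only [Finset.mem_sigma, Finset.mem_compl, Finset.mem_insert, not_or] at h ⊢
    exact ⟨h.2.2, Ne.symm h.2.1, h.1⟩
  · intros
    rfl

variable (A) in
/-- Exterior multiplication by the basis vector `e_a`. -/
def wedge (a : Fin m) : (Finset (Fin m) → M) →ₗ[A] (Finset (Fin m) → M) where
  toFun f T := if a ∈ T then sign A a (T.erase a) • f (T.erase a) else 0
  map_add' f f' := by
    funext T
    by_cases h : a ∈ T <;> simp [h]
  map_smul' c f := by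
    funext T
    by_cases h : a ∈ T <;> simp [h, smul_comm c]

theorem wedge_apply_of_notMem {a : Fin m} (f : Finset (Fin m) → M) {T : Finset (Fin m)}
    (h : a ∉ T) : wedge A a f T = 0 := if_neg h

theorem wedge_apply_insert {a : Fin m} (f : Finset (Fin m) → M) {T : Finset (Fin m)}
    (h : a ∉ T) : wedge A a f (insert a T) = sign A a T • f T := by
  change ite _ _ _ = _
  rw [if_pos (Finset.mem_insert_self a T), Finset.erase_insert h]

/-- Multiplication by `u a` is null-homotopic on the Koszul complex of `u`. -/
theorem diff_wedge (u : Fin m → A) (a : Fin m) (f : Finset (Fin m) → M) :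
    diff u (wedge A a f) = u a • f - wedge A a (diff u f) := by
  rw [eq_sub_iff_add_eq]
  funext T
  rw [Pi.add_apply, Pi.smul_apply]
  by_cases ha : a ∈ T
  · obtain ⟨T, haT, rfl⟩ : ∃ T', a ∉ T' ∧ insert a T' = T :=
      ⟨T.erase a, Finset.notMem_erase a T, Finset.insert_erase ha⟩
    rw [wedge_apply_insert _ haT, diff_apply, diff_apply,
      show Tᶜ = insert a (insert a T)ᶜ by
        ext j; by_cases hj : j = a <;> simp [hj, haT],
      Finset.sum_insert (by simp), smul_add, smul_smul, ← mul_assoc, sign_mul_self, one_mul,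
      add_left_comm, add_eq_left, Finset.smul_sum, ← Finset.sum_add_distrib]
    refine Finset.sum_eq_zero fun j hj => ?_
    simp only [Finset.mem_compl, Finset.mem_insert, not_or] at hj
    have hs := sign_insert (A := A) hj.2 haT hj.1
    rw [Finset.insert_comm, wedge_apply_insert _ (by simp [haT, Ne.symm hj.1]), smul_smul, smul_smul,
      ← add_smul]
    convert zero_smul A _
    linear_combination (sign A j T * sign A j (insert a T) * u j) * hs
      - (sign A j (insert a T) * sign A a (insert j T) * u j) * sign_mul_self (A := A) j T
      - (sign A a T * sign A j T * u j) * sign_mul_self (A := A) j (insert a T)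
  · rw [wedge_apply_of_notMem _ ha, add_zero, diff_apply, Finset.sum_eq_single a,
      wedge_apply_insert _ ha, smul_smul, mul_right_comm, sign_mul_self, one_mul]
    · intro j _ hja
      rw [wedge_apply_of_notMem _ (by simp [ha, Ne.symm hja]), smul_zero]
    · intro h
      simp [ha] at h

variable (A M) in
/-- The degree `i` chains of the Koszul complex of the subsequence indexed by `J`. -/
def homog (J : Finset (Fin m)) (i : ℕ) : Submodule A (Finset (Fin m) → M) where
  carrier := {f | ∀ T, ¬(T ⊆ J ∧ T.card = i) → f T = 0}
  add_mem' hf hg T hT := by simp [hf T hT, hg T hT]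
  zero_mem' _ _ := rfl
  smul_mem' c f hf T hT := by simp [hf T hT]

theorem diff_mem_homog (u : Fin m → A) {J : Finset (Fin m)} {i : ℕ} {f : Finset (Fin m) → M}
    (hf : f ∈ homog A M J (i + 1)) : diff u f ∈ homog A M J i := by
  intro T hT
  rw [diff_apply]
  refine Finset.sum_eq_zero fun j hj => ?_
  rw [hf, smul_zero]
  rw [Finset.mem_compl] at hj
  rw [Finset.card_insert_of_notMem hj, Nat.succ_inj]
  exact fun h => hT ⟨(Finset.subset_insert j T).trans h.1, h.2⟩

theorem diff_eq_zero_of_mem_homog_zero (u : Fin m → A) {J : Finset (Fin m)}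
    {f : Finset (Fin m) → M} (hf : f ∈ homog A M J 0) : diff u f = 0 := by
  funext T
  rw [diff_apply]
  refine Finset.sum_eq_zero fun j hj => ?_
  rw [hf, smul_zero]
  simp

theorem wedge_mem_homog {a : Fin m} {J : Finset (Fin m)} {i : ℕ} {f : Finset (Fin m) → M}
    (hf : f ∈ homog A M J i) : wedge A a f ∈ homog A M (insert a J) (i + 1) := by
  intro T hT
  by_cases ha : a ∈ T
  · obtain ⟨T, haT, rfl⟩ : ∃ T', a ∉ T' ∧ insert a T' = T :=
      ⟨T.erase a, Finset.notMem_erase a T, Finset.insert_erase ha⟩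
    rw [wedge_apply_insert _ haT, hf, smul_zero]
    rw [Finset.card_insert_of_notMem haT, Nat.succ_inj] at hT
    exact fun h => hT ⟨Finset.insert_subset_insert a h.1, h.2⟩
  · exact wedge_apply_of_notMem _ ha

theorem homog_mono {J J' : Finset (Fin m)} (h : J ⊆ J') (i : ℕ) :
    homog A M J i ≤ homog A M J' i :=
  fun _ hf T hT => hf T fun h' => hT ⟨h'.1.trans h, h'.2⟩

theorem eq_zero_of_mem_homog_of_card_lt {J : Finset (Fin m)} {i : ℕ} (hi : J.card < i)
    {f : Finset (Fin m) → M} (hf : f ∈ homog A M J i) : f = 0 := by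
  funext T
  exact hf T fun h => absurd (Finset.card_le_card h.1) (by omega)

/-- The Koszul complex of `J ∪ {a}` is the mapping cone of `u a` on that of `J`; with
`eq_zero_of_wedge_mem_homog`, this splitting replaces the long exact homology sequence of the cone.
-/
theorem exists_eq_add_wedge {a : Fin m} {J : Finset (Fin m)} {i : ℕ}
    {f : Finset (Fin m) → M} (hf : f ∈ homog A M (insert a J) (i + 1)) :
    ∃ f₀ ∈ homog A M J (i + 1), ∃ f₁ ∈ homog A M J i, f = f₀ + wedge A a f₁ := by
  classical
  refine ⟨fun T => if a ∈ T then 0 else f T, ?_,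
    fun T => if a ∈ T then 0 else sign A a T • f (insert a T), ?_, ?_⟩
  · intro T hT
    by_cases h : a ∈ T
    · exact if_pos h
    · exact (if_neg h).trans (hf T fun h' => hT ⟨(Finset.subset_insert_iff_of_notMem h).1 h'.1, h'.2⟩)
  · intro T hT
    by_cases h : a ∈ T
    · exact if_pos h
    · refine (if_neg h).trans ?_
      rw [hf, smul_zero]
      rw [Finset.card_insert_of_notMem h, Nat.succ_inj]
      exact fun h' => hT ⟨(Finset.subset_insert_iff_of_notMem h).1
        ((Finset.subset_insert a T).trans h'.1), h'.2⟩
  · funext T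
    rw [Pi.add_apply]
    by_cases ha : a ∈ T
    · obtain ⟨T, haT, rfl⟩ : ∃ T', a ∉ T' ∧ insert a T' = T :=
        ⟨T.erase a, Finset.notMem_erase a T, Finset.insert_erase ha⟩
      rw [wedge_apply_insert _ haT, if_pos ha, if_neg haT, zero_add, smul_smul, sign_mul_self,
        one_smul]
    · rw [wedge_apply_of_notMem _ ha, if_neg ha, add_zero]

theorem eq_zero_of_wedge_mem_homog {a : Fin m} {J : Finset (Fin m)} (haJ : a ∉ J) {i j : ℕ}
    {f : Finset (Fin m) → M} (hf : f ∈ homog A M J i) (h : wedge A a f ∈ homog A M J j) :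
    f = 0 := by
  funext T
  by_cases hT : T ⊆ J
  · have haT : a ∉ T := fun h' => haJ (hT h')
    have := h (insert a T) fun h' => haJ (h'.1 (Finset.mem_insert_self a T))
    rw [wedge_apply_insert _ haT] at this
    rw [Pi.zero_apply, ← one_smul A (f T), ← sign_mul_self a T, mul_smul, this, smul_zero]
  · exact hf T fun h' => hT h'.1

end TotalComplex

/-! ### Rigidity of Koszul homology at a prime -/

section Rigidity

variable {A : Type*} [CommRing A] {m : ℕ} {M : Type*} [AddCommGroup M] [Module A M]

variable (M) in
/-- The Koszul complex of the `u j`, `j ∈ J`, with coefficients in `M` becomes exact in degree `i`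
after localization at `p`. -/
def ExactAt (u : Fin m → A) (p : Ideal A) (J : Finset (Fin m)) (i : ℕ) : Prop :=
  ∀ z ∈ homog A M J i, diff u z = 0 → ∃ s ∉ p, ∃ w ∈ homog A M J (i + 1), diff u w = s • z

/-- Nakayama over the localization at `p`, phrased without localizing: the support of `Q/xQ` is that
of `Q` cut by `V(x)`, and `p` lies in `V(x)`. -/
theorem exists_smul_eq_zero_of_forall_exists_smul_eq_smul {Q : Type*} [AddCommGroup Q] [Module A Q]
    [Module.Finite A Q] (p : Ideal A) [hp : p.IsPrime] {x : A} (hx : x ∈ p)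
    (h : ∀ q : Q, ∃ s ∉ p, ∃ q', s • q = x • q') (q : Q) : ∃ s ∉ p, s • q = 0 := by
  have hQ : (⟨p, hp⟩ : PrimeSpectrum A) ∉ Module.support A (QuotSMulTop x Q) := by
    rw [Module.notMem_support_iff']
    intro y
    obtain ⟨y, rfl⟩ := Submodule.Quotient.mk_surjective _ y
    obtain ⟨s, hs, q', hq'⟩ := h y
    refine ⟨s, hs, ?_⟩
    rw [← Submodule.Quotient.mk_smul, hq', Submodule.Quotient.mk_eq_zero]
    exact Submodule.smul_mem_pointwise_smul _ _ _ trivial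
  rw [Module.support_quotSMulTop] at hQ
  have hQ' : (⟨p, hp⟩ : PrimeSpectrum A) ∉ Module.support A Q :=
    fun h => hQ ⟨h, by simpa using hx⟩
  exact Module.notMem_support_iff'.1 hQ' q

/-- The cone sequence embeds `H_i(J) / u_a H_i(J)` into `H_i(J ∪ {a})`. If the latter vanishes at
`p`, Nakayama kills `H_i(J)` at `p`. -/
theorem exactAt_of_exactAt_insert [IsNoetherianRing A] [Module.Finite A M] (u : Fin m → A)
    (p : Ideal A) [p.IsPrime] {J : Finset (Fin m)} {a : Fin m} (ha : a ∉ J) (hap : u a ∈ p) {i : ℕ}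
    (h : ExactAt M u p (insert a J) i) : ExactAt M u p J i := by
  let Z : Submodule A (Finset (Fin m) → M) := homog A M J i ⊓ LinearMap.ker (diff u)
  let B : Submodule A (Finset (Fin m) → M) := (homog A M J (i + 1)).map (diff u)
  have key := exists_smul_eq_zero_of_forall_exists_smul_eq_smul (Q := Z ⧸ B.submoduleOf Z) p hap ?_
  · intro z hz hz0
    obtain ⟨s, hs, hsz⟩ := key (Submodule.Quotient.mk ⟨z, hz, hz0⟩)
    rw [← Submodule.Quotient.mk_smul, Submodule.Quotient.mk_eq_zero] at hsz
    obtain ⟨w, hw, hw'⟩ := hsz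
    exact ⟨s, hs, w, hw, hw'⟩
  · intro q
    obtain ⟨⟨z, hz, hz0⟩, rfl⟩ := Submodule.Quotient.mk_surjective _ q
    obtain ⟨s, hs, w, hw, hwz⟩ := h z (homog_mono (Finset.subset_insert a J) i hz) hz0
    obtain ⟨w₀, hw₀, w₁, hw₁, rfl⟩ := exists_eq_add_wedge hw
    rw [map_add, diff_wedge] at hwz
    have hmem : wedge A a (diff u w₁) ∈ homog A M J i := by
      have : wedge A a (diff u w₁) = diff u w₀ + u a • w₁ - s • z := by
        rw [← hwz]; abel
      rw [this]
      exact sub_mem (add_mem (diff_mem_homog u hw₀) (Submodule.smul_mem _ _ hw₁))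
        (Submodule.smul_mem _ _ hz)
    -- The cycle `z` does not involve `e_a`, so the `e_a`-component of `diff u w` must vanish; what
    -- remains reads `s z = diff u w₀ + u_a w₁`.
    have hw₁0 : diff u w₁ = 0 := by
      cases i with
      | zero => exact diff_eq_zero_of_mem_homog_zero u hw₁
      | succ i => exact eq_zero_of_wedge_mem_homog ha (diff_mem_homog u hw₁) hmem
    refine ⟨s, hs, Submodule.Quotient.mk ⟨w₁, hw₁, hw₁0⟩, ?_⟩
    rw [← Submodule.Quotient.mk_smul, ← Submodule.Quotient.mk_smul, Submodule.Quotient.eq]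
    refine ⟨w₀, hw₀, ?_⟩
    rw [hw₁0, map_zero, sub_zero] at hwz
    change diff u w₀ = s • z - u a • w₁
    rw [← hwz, add_sub_cancel_right]

/-- Rigidity of the Koszul complex. -/
theorem ExactAt.succ [IsNoetherianRing A] [Module.Finite A M] (u : Fin m → A)
    (p : Ideal A) [p.IsPrime] {J : Finset (Fin m)} (hJ : ∀ j ∈ J, u j ∈ p) {i : ℕ}
    (h : ExactAt M u p J i) : ExactAt M u p J (i + 1) := by
  induction J using Finset.induction_on with
  | empty =>
    intro z hz _
    refine ⟨1, (Ideal.ne_top_iff_one p).1 (Ideal.IsPrime.ne_top ‹_›), 0, zero_mem _, ?_⟩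
    rw [eq_zero_of_mem_homog_of_card_lt (by simp) hz, smul_zero, map_zero]
  | insert a J ha ih =>
    have h₁ := exactAt_of_exactAt_insert u p ha (hJ a (Finset.mem_insert_self a J)) h
    have h₂ := ih (fun j hj => hJ j (Finset.mem_insert_of_mem hj)) h₁
    intro z hz hz0
    obtain ⟨z₀, hz₀, z₁, hz₁, rfl⟩ := exists_eq_add_wedge hz
    rw [map_add, diff_wedge] at hz0
    have hz₁0 : diff u z₁ = 0 := by
      cases i with
      | zero => exact diff_eq_zero_of_mem_homog_zero u hz₁
      | succ i =>
        refine eq_zero_of_wedge_mem_homog ha (diff_mem_homog u hz₁) (j := i + 1) ?_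
        have : wedge A a (diff u z₁) = diff u z₀ + u a • z₁ := by
          rw [← sub_eq_zero, ← neg_eq_zero, ← hz0]; abel
        rw [this]
        exact add_mem (diff_mem_homog u hz₀) (Submodule.smul_mem _ _ hz₁)
    -- `H_{i+1}(J ∪ {a})` lies between `H_{i+1}(J)` and `H_i(J)`, both zero at `p`: bound `z₁`
    -- first, then correct `z₀` by `u_a w₁` to make it a cycle.
    obtain ⟨s, hs, w₁, hw₁, hw₁z⟩ := h₁ z₁ hz₁ hz₁0
    have hy : diff u (wedge A a w₁) = u a • w₁ - s • wedge A a z₁ := by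
      rw [diff_wedge, hw₁z, map_smul]
    obtain ⟨s', hs', w, hw, hwy⟩ := h₂ (s • z₀ + u a • w₁)
      (add_mem (Submodule.smul_mem _ _ hz₀) (Submodule.smul_mem _ _ hw₁)) (by
        rw [map_add, map_smul, map_smul, hw₁z, smul_comm, ← smul_add]
        rw [hz₁0, map_zero, sub_zero] at hz0
        rw [hz0, smul_zero])
    refine ⟨s' * s, fun h => (Ideal.IsPrime.mem_or_mem ‹_› h).elim hs' hs,
      w - s' • wedge A a w₁, sub_mem (homog_mono (Finset.subset_insert a J) _ hw)
        (Submodule.smul_mem _ _ (wedge_mem_homog hw₁)), ?_⟩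
    rw [map_sub, map_smul, hwy, hy, mul_smul, ← smul_sub, smul_add s]
    congr 1
    abel

end Rigidity

end Koszul

namespace Koszul

open RingTheory.Sequence

/-! ### Koszul homology and regular sequences in the ideal -/

section RegularSequence

variable {A : Type*} [CommRing A] {m : ℕ} {M : Type*} [AddCommGroup M] [Module A M]

/-- Extends the null-homotopy of each `u a` linearly to the ideal they generate. -/
theorem exists_smul_eq_diff (u : Fin m → A) {x : A} (hx : x ∈ Ideal.span (Set.range u)) {i : ℕ}
    {f : Finset (Fin m) → M} (hf : f ∈ homog A M Finset.univ i) (hf0 : diff u f = 0) :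
    ∃ h ∈ homog A M Finset.univ (i + 1), diff u h = x • f := by
  induction hx using Submodule.span_induction with
  | mem x hx =>
    obtain ⟨a, rfl⟩ := hx
    refine ⟨wedge A a f, homog_mono (Finset.subset_univ _) _ (wedge_mem_homog hf), ?_⟩
    rw [diff_wedge, hf0, map_zero, sub_zero]
  | zero => exact ⟨0, zero_mem _, by simp⟩
  | add x y _ _ hx hy =>
    obtain ⟨h, hh, hx⟩ := hx
    obtain ⟨h', hh', hy⟩ := hy
    exact ⟨h + h', add_mem hh hh', by rw [map_add, hx, hy, add_smul]⟩
  | smul c x _ hx =>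
    obtain ⟨h, hh, hx⟩ := hx
    exact ⟨c • h, Submodule.smul_mem _ _ hh, by rw [map_smul, hx, smul_assoc]⟩

theorem diff_mk (u : Fin m → A) (x : A) (f : Finset (Fin m) → M) :
    diff u (fun T => (Submodule.Quotient.mk (f T) : QuotSMulTop x M)) =
      fun T => Submodule.Quotient.mk (diff u f T) := by
  funext T
  simp only [diff_apply, ← Submodule.mkQ_apply, map_sum, map_smul]

theorem exists_lift {J : Finset (Fin m)} {i : ℕ} {x : A}
    {f : Finset (Fin m) → QuotSMulTop x M} (hf : f ∈ homog A (QuotSMulTop x M) J i) :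
    ∃ f' ∈ homog A M J i, f = fun T => Submodule.Quotient.mk (f' T) := by
  classical
  choose g hg using fun T => Submodule.Quotient.mk_surjective _ (f T)
  refine ⟨fun T => if T ⊆ J ∧ T.card = i then g T else 0, fun T hT => if_neg hT, ?_⟩
  funext T
  by_cases hT : T ⊆ J ∧ T.card = i
  · simp only [if_pos hT, hg]
  · simp only [if_neg hT, hf T hT, Submodule.Quotient.mk_zero]

theorem exists_eq_smul {J : Finset (Fin m)} {i : ℕ} {x : A}
    {f : Finset (Fin m) → M} (hf : f ∈ homog A M J i)
    (h : ∀ T, (Submodule.Quotient.mk (f T) : QuotSMulTop x M) = 0) :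
    ∃ w ∈ homog A M J i, f = x • w := by
  classical
  have h' : ∀ T, ∃ y, f T = x • y := fun T => by
    obtain ⟨y, _, hy⟩ := (Submodule.mem_smul_pointwise_iff_exists _ _ _).1
      ((Submodule.Quotient.mk_eq_zero _).1 (h T))
    exact ⟨y, hy.symm⟩
  choose g hg using h'
  refine ⟨fun T => if T ⊆ J ∧ T.card = i then g T else 0, fun T hT => if_neg hT, ?_⟩
  funext T
  rw [Pi.smul_apply]
  by_cases hT : T ⊆ J ∧ T.card = i
  · rw [if_pos hT, hg]
  · rw [if_neg hT, hf T hT, smul_zero]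

theorem smul_injective_of_isSMulRegular {x : A} (hx : IsSMulRegular M x)
    {f f' : Finset (Fin m) → M} (h : x • f = x • f') : f = f' :=
  funext fun T => hx (congrFun h T)

end RegularSequence

section

universe v

variable {A : Type*} [CommRing A] {m : ℕ}

/-- A weakly regular sequence of length `k` in the ideal generated by `u` makes the Koszul homology
vanish in degrees greater than `m - k`. -/
theorem exists_diff_eq_of_isWeaklyRegular (u : Fin m → A) (rs : List A)
    (hrs : ∀ r ∈ rs, r ∈ Ideal.span (Set.range u)) (M : Type v) [AddCommGroup M] [Module A M]
    (h : IsWeaklyRegular M rs) {i : ℕ} (hi : m < i + rs.length) {f : Finset (Fin m) → M}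
    (hf : f ∈ homog A M Finset.univ i) (hf0 : diff u f = 0) :
    ∃ g ∈ homog A M Finset.univ (i + 1), diff u g = f := by
  induction rs generalizing M i with
  | nil =>
    refine ⟨0, zero_mem _, ?_⟩
    rw [eq_zero_of_mem_homog_of_card_lt (by simpa using hi) hf, map_zero]
  | cons x rs ih =>
    rw [isWeaklyRegular_cons_iff] at h
    -- Modulo `x`, the chain `e` is a cycle one degree higher, hence a boundary by induction.
    -- Lifting gives `e - diff u g = x w`, and cancelling `x` in `x • diff u w = x • f` finishes.
    obtain ⟨e, he, hex⟩ := exists_smul_eq_diff u (hrs x List.mem_cons_self) hf hf0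
    have he' : (fun T => (Submodule.Quotient.mk (e T) : QuotSMulTop x M)) ∈
        homog A (QuotSMulTop x M) Finset.univ (i + 1) := fun T hT => by
      simp only [he T hT, Submodule.Quotient.mk_zero]
    obtain ⟨g, hg, hge⟩ := ih (fun r hr => hrs r (List.mem_cons_of_mem x hr)) (QuotSMulTop x M) h.2
      (i := i + 1) (by simp only [List.length_cons] at hi; omega) he' (by
        rw [diff_mk, hex]
        funext T
        rw [Pi.smul_apply, Pi.zero_apply, Submodule.Quotient.mk_eq_zero]
        exact Submodule.smul_mem_pointwise_smul _ _ _ trivial)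
    obtain ⟨g, hg', rfl⟩ := exists_lift hg
    rw [diff_mk] at hge
    obtain ⟨w, hw, hw'⟩ := exists_eq_smul (x := x) (sub_mem he (diff_mem_homog u hg'))
      fun T => by
        have := congrFun hge T
        rw [Pi.sub_apply, Submodule.Quotient.mk_sub, ← this, sub_self]
    refine ⟨w, hw, smul_injective_of_isSMulRegular h.1 ?_⟩
    rw [← map_smul, ← hw', map_sub, diff_diff, sub_zero, hex]

/-- If `rs` is a weakly regular sequence of length `k` in the ideal generated by `u`, and `p` is an
associated prime of `M / rs M` that contains `u`, then the Koszul homology in degree `m - k`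
is nonzero at `p`. -/
theorem exists_cycle_of_isAssociatedPrime [IsNoetherianRing A] (u : Fin m → A) (rs : List A)
    (hrs : ∀ r ∈ rs, r ∈ Ideal.span (Set.range u)) (hm : rs.length ≤ m)
    (M : Type v) [AddCommGroup M] [Module A M]
    (h : IsWeaklyRegular M rs) (p : Ideal A) (hu : ∀ j, u j ∈ p)
    (hp : IsAssociatedPrime p (M ⧸ (Ideal.ofList rs • ⊤ : Submodule A M))) :
    ¬ ExactAt M u p Finset.univ (m - rs.length) := by
  induction rs generalizing M with
  | nil =>
    have e : (M ⧸ (Ideal.ofList ([] : List A) • ⊤ : Submodule A M)) ≃ₗ[A] M :=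
      Submodule.quotEquivOfEqBot _ (by simp)
    obtain ⟨_, n, rfl⟩ := isAssociatedPrime_iff.1 (e.isAssociatedPrime_iff.1 hp)
    intro h
    classical
    -- In top degree the cycles are the elements killed by all `u j`. The element `n` with
    -- annihilator `p` is one of them, and there are no boundaries.
    obtain ⟨s, hs, w, hw, hws⟩ := h (fun T => if T = Finset.univ then n else 0) (fun T hT => by
        refine if_neg fun h => hT ?_
        subst h
        simp) (by
        funext T
        rw [diff_apply]
        refine Finset.sum_eq_zero fun j _ => ?_
        have := hu j
        rw [Submodule.mem_colon_singleton, Submodule.mem_bot] at this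
        split_ifs <;> simp [mul_smul, this])
    rw [eq_zero_of_mem_homog_of_card_lt (by simp) hw, map_zero] at hws
    have := congrFun hws Finset.univ
    simp only [Pi.smul_apply, if_true, Pi.zero_apply] at this
    exact hs (by rw [Submodule.mem_colon_singleton, Submodule.mem_bot, this])
  | cons x rs ih =>
    rw [isWeaklyRegular_cons_iff] at h
    simp only [List.length_cons] at hm ⊢
    have hrs' : ∀ r ∈ rs, r ∈ Ideal.span (Set.range u) :=
      fun r hr => hrs r (List.mem_cons_of_mem x hr)
    have := ih hrs' (by omega) (QuotSMulTop x M) h.2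
      ((Submodule.quotOfListConsSMulTopEquivQuotSMulTopInner M x rs).isAssociatedPrime_iff.1 hp)
    -- The connecting map `H_{k+1}(M/xM) → H_k(M)` is injective because `H_{k+1}(M) = 0`, so
    -- exactness at `p` in degree `k` for `M` would contradict the induction hypothesis for `M/xM`.
    intro hex
    refine this fun z hz hz0 => ?_
    obtain ⟨f, hf, rfl⟩ := exists_lift hz
    rw [diff_mk] at hz0
    obtain ⟨k, hk⟩ : ∃ k, m - rs.length = k + 1 := ⟨m - rs.length - 1, by omega⟩
    rw [hk] at hf hz ⊢
    rw [show m - (rs.length + 1) = k by omega] at hex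
    obtain ⟨w, hw, hfw⟩ := exists_eq_smul (x := x) (diff_mem_homog u hf) (congrFun hz0)
    have hw0 : diff u w = 0 := by
      refine smul_injective_of_isSMulRegular h.1 ?_
      rw [← map_smul, ← hfw, diff_diff, smul_zero]
    obtain ⟨s, hs, g, hg, hgw⟩ := hex w hw hw0
    obtain ⟨b, hb, hbf⟩ := exists_diff_eq_of_isWeaklyRegular u (x :: rs) hrs M
      ((isWeaklyRegular_cons_iff _ _ _).2 h) (i := k + 1)
      (by simp only [List.length_cons]; omega)
      (sub_mem (Submodule.smul_mem _ s hf) (Submodule.smul_mem _ x hg))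
      (by rw [map_sub, map_smul, map_smul, hfw, hgw, smul_comm, sub_self])
    refine ⟨s, hs, fun T => Submodule.Quotient.mk (b T), fun T hT => ?_, ?_⟩
    · simp only [hb T hT, Submodule.Quotient.mk_zero]
    · rw [diff_mk, hbf]
      funext T
      rw [Pi.sub_apply, Submodule.Quotient.mk_sub, Pi.smul_apply, Pi.smul_apply, Pi.smul_apply,
        Submodule.Quotient.mk_smul, sub_eq_self, Submodule.Quotient.mk_eq_zero]
      exact Submodule.smul_mem_pointwise_smul _ _ _ trivial

end

/-! ### Transfer to the graded modules `Koszul.H` -/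

section Comparison

variable {A : Type*} [CommRing A] {m : ℕ}

/-- Extension by zero of a chain of degree `i`. -/
def extend (i : ℕ) : Chain A m i →ₗ[A] (Finset (Fin m) → A) where
  toFun f T := if h : T.card = i then f ⟨T, h⟩ else 0
  map_add' f f' := by
    funext T
    by_cases h : T.card = i <;> simp [h]
  map_smul' c f := by
    funext T
    by_cases h : T.card = i <;> simp [h]

theorem extend_apply {i : ℕ} (f : Chain A m i) (T : {S : Finset (Fin m) // S.card = i}) :
    extend i f T.1 = f T := dif_pos T.2

theorem extend_injective (i : ℕ) : Function.Injective (extend (A := A) (m := m) i) := by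
  intro f f' h
  funext T
  rw [← extend_apply f, h, extend_apply]

theorem extend_mem_homog {i : ℕ} (f : Chain A m i) : extend i f ∈ homog A A Finset.univ i :=
  fun _ hT => dif_neg fun h => hT ⟨Finset.subset_univ _, h⟩

theorem exists_extend_eq {i : ℕ} {f : Finset (Fin m) → A} (hf : f ∈ homog A A Finset.univ i) :
    ∃ f', extend i f' = f := by
  refine ⟨fun T => f T.1, ?_⟩
  funext T
  by_cases h : T.card = i
  · exact dif_pos h
  · exact (dif_neg h).trans (hf T fun h' => h h'.2).symm

theorem diff_extend (u : Fin m → A) {i : ℕ} (f : Chain A m (i + 1)) :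
    diff u (extend (i + 1) f) = extend i (d u i f) := by
  funext T
  by_cases h : T.card = i
  · rw [extend_apply (d u i f) ⟨T, h⟩, diff_apply]
    refine (Finset.sum_subtype (p := fun j => j ∉ T) Tᶜ (by simp) _).trans (Finset.sum_congr rfl fun j _ => ?_)
    rw [smul_eq_mul, extend_apply f ⟨insert j.1 T, by rw [Finset.card_insert_of_notMem j.2, h]⟩]
  · rw [diff_mem_homog u (extend_mem_homog f) T fun h' => h h'.2,
      extend_mem_homog _ T fun h' => h h'.2]

theorem mem_cycles_iff (u : Fin m → A) {i : ℕ} (f : Chain A m i) :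
    f ∈ cycles u i ↔ diff u (extend i f) = 0 := by
  cases i with
  | zero => exact iff_of_true trivial (diff_eq_zero_of_mem_homog_zero u (extend_mem_homog f))
  | succ i =>
    rw [diff_extend, map_eq_zero_iff _ (extend_injective i)]
    exact LinearMap.mem_ker

theorem mem_boundaries_iff (u : Fin m → A) {i : ℕ} (f : Chain A m i) :
    f ∈ boundaries u i ↔ ∃ g ∈ homog A A Finset.univ (i + 1), diff u g = extend i f := by
  constructor
  · rintro ⟨g, rfl⟩
    exact ⟨_, extend_mem_homog g, diff_extend u g⟩
  · rintro ⟨g, hg, hgf⟩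
    obtain ⟨g, rfl⟩ := exists_extend_eq hg
    rw [diff_extend] at hgf
    exact ⟨g, extend_injective i hgf⟩

theorem notMem_support_iff_exactAt (u : Fin m → A) (p : PrimeSpectrum A) (i : ℕ) :
    p ∉ Module.support A (H u i) ↔ ExactAt A u p.asIdeal Finset.univ i := by
  rw [Module.notMem_support_iff']
  constructor
  · intro h z hz hz0
    obtain ⟨z, rfl⟩ := exists_extend_eq hz
    obtain ⟨s, hs, hsz⟩ := h (Submodule.Quotient.mk ⟨z, (mem_cycles_iff u z).2 hz0⟩)
    rw [← Submodule.Quotient.mk_smul, Submodule.Quotient.mk_eq_zero] at hsz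
    refine ⟨s, hs, ?_⟩
    rw [← map_smul]
    exact (mem_boundaries_iff u (s • z)).1 hsz
  · intro h q
    obtain ⟨z, rfl⟩ := Submodule.Quotient.mk_surjective _ q
    obtain ⟨s, hs, hsz⟩ := h _ (extend_mem_homog z.1) ((mem_cycles_iff u z.1).1 z.2)
    refine ⟨s, hs, ?_⟩
    rw [← Submodule.Quotient.mk_smul, Submodule.Quotient.mk_eq_zero]
    rw [← map_smul] at hsz
    exact (mem_boundaries_iff u (s • z.1)).2 hsz

theorem le_annihilator_H (u : Fin m → A) (i : ℕ) :
    Ideal.span (Set.range u) ≤ Module.annihilator A (H u i) := by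
  intro x hx
  rw [Module.mem_annihilator]
  intro q
  obtain ⟨z, rfl⟩ := Submodule.Quotient.mk_surjective _ q
  rw [← Submodule.Quotient.mk_smul, Submodule.Quotient.mk_eq_zero]
  refine (mem_boundaries_iff u (x • z.1)).2 ?_
  rw [map_smul]
  exact exists_smul_eq_diff u hx (extend_mem_homog z.1) ((mem_cycles_iff u z.1).1 z.2)

theorem cycles_le_boundaries_of_isWeaklyRegular (u : Fin m → A) (rs : List A)
    (hrs : ∀ r ∈ rs, r ∈ Ideal.span (Set.range u)) (h : IsWeaklyRegular A rs) {i : ℕ}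
    (hi : m < i + rs.length) : cycles u i ≤ boundaries u i := fun z hz =>
  (mem_boundaries_iff u z).2 <| exists_diff_eq_of_isWeaklyRegular u rs hrs A h hi
    (extend_mem_homog z) ((mem_cycles_iff u z).1 hz)

/-- If `H_i` vanished at `p`, rigidity would propagate the vanishing up to degree `m - rs.length`,
where the homology is nonzero at `p`. -/
theorem mem_support_H_of_isAssociatedPrime [IsNoetherianRing A] (u : Fin m → A) (rs : List A)
    (hrs : ∀ r ∈ rs, r ∈ Ideal.span (Set.range u)) (hm : rs.length ≤ m)
    (h : IsWeaklyRegular A rs) (p : PrimeSpectrum A) (hu : ∀ j, u j ∈ p.asIdeal)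
    (hp : IsAssociatedPrime p.asIdeal (A ⧸ (Ideal.ofList rs • ⊤ : Submodule A A))) {i : ℕ}
    (hi : i ≤ m - rs.length) : p ∈ Module.support A (H u i) := by
  by_contra hi'
  rw [notMem_support_iff_exactAt] at hi'
  refine exists_cycle_of_isAssociatedPrime u rs hrs hm A h p.asIdeal hu hp ?_
  clear hm hp
  generalize m - rs.length = n at hi ⊢
  induction hi with
  | refl => exact hi'
  | step _ ih => exact ih.succ u p.asIdeal fun j _ => hu j

end Comparison

end Koszul

/-! ### Dimension and support -/

section SupportDim

open Module

theorem supportDim_le_of_support_subset {R M N : Type*} [CommRing R] [AddCommGroup M] [Module R M]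
    [AddCommGroup N] [Module R N] (h : Module.support R M ⊆ Module.support R N) :
    supportDim R M ≤ supportDim R N :=
  Order.krullDim_le_of_strictMono (fun a => ⟨a.1, h a.2⟩) fun {_ _} lt => lt

theorem support_quotient_eq_zeroLocus {R : Type*} [CommRing R] (I : Ideal R) :
    Module.support R (R ⧸ I) = PrimeSpectrum.zeroLocus (I : Set R) := by
  rw [Module.support_eq_zeroLocus, Ideal.annihilator_quotient]

theorem WithBot.ENat.le_of_add_one_le {a b : WithBot ℕ∞} (h : a + 1 ≤ b + 1) : a ≤ b := by
  induction a with
  | bot => exact bot_le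
  | coe a =>
    induction b with
    | bot => simp at h
    | coe b =>
      norm_cast at h ⊢
      exact (ENat.add_le_add_iff_right ENat.one_ne_top).1 h

end SupportDim

/-! ### Regular local rings have a regular sequence of full length -/

section RegularLocalRing

open IsLocalRing Module RingTheory.Sequence Pointwise

universe u

theorem ringKrullDim_le_length {R : Type*} [CommRing R] [IsLocalRing R] [IsNoetherianRing R]
    (xs : List R) (hxs : Ideal.ofList xs = maximalIdeal R) :
    ringKrullDim R ≤ xs.length := by
  classical
  refine (ringKrullDim_le_spanFinrank_maximalIdeal R).trans ?_
  have hspan : Ideal.ofList xs = Submodule.span R (xs.toFinset : Set R) :=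
    congrArg Ideal.span (Set.ext fun a => by simp)
  rw [← hxs, hspan]
  have h := Submodule.spanFinrank_span_le_ncard_of_finite (R := R) (s := (xs.toFinset : Set R))
    (Finset.finite_toSet _)
  rw [Set.ncard_coe_finset] at h
  exact_mod_cast h.trans (List.toFinset_card_le xs)

theorem exists_prime_le_ringKrullDim_quotient {R : Type*} [CommRing R] {n : ℕ}
    (h : (n : WithBot ℕ∞) ≤ ringKrullDim R) :
    ∃ p : PrimeSpectrum R, (n : WithBot ℕ∞) ≤ ringKrullDim (R ⧸ p.asIdeal) := by
  obtain ⟨l, rfl⟩ := Order.le_krullDim_iff.1 h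
  refine ⟨l.head, ?_⟩
  rw [ringKrullDim_quotient]
  let l' : LTSeries (PrimeSpectrum.zeroLocus (R := R) l.head.asIdeal) :=
    { length := l.length
      toFun := fun i => ⟨l i, LTSeries.head_le l i⟩
      step := fun i => l.step i }
  exact Order.LTSeries.length_le_krullDim l'

theorem isSMulRegular_quotient_of_notMem {R : Type*} [CommRing R] {p : Ideal R} (hp : p.IsPrime)
    {x : R} (hx : x ∉ p) : IsSMulRegular (R ⧸ p) x := by
  rw [isSMulRegular_iff_right_eq_zero_of_smul]
  intro y hy
  obtain ⟨y, rfl⟩ := Ideal.Quotient.mk_surjective y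
  replace hy : x * y ∈ p := Ideal.Quotient.eq_zero_iff_mem.1 hy
  exact Ideal.Quotient.eq_zero_iff_mem.2 ((hp.mem_or_mem hy).resolve_left hx)

/-- A local ring of dimension `n` whose maximal ideal is generated by `n` elements is a domain, and
these elements form a regular sequence. -/
theorem isDomain_and_isWeaklyRegular_of_ofList_eq_maximalIdeal (n : ℕ) (R : Type u) [CommRing R]
    [IsLocalRing R] [IsNoetherianRing R] (xs : List R) (hn : xs.length = n)
    (hxs : Ideal.ofList xs = maximalIdeal R)
    (hdim : (n : WithBot ℕ∞) ≤ ringKrullDim R) : IsDomain R ∧ IsWeaklyRegular R xs := by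
  induction n generalizing R with
  | zero =>
    obtain rfl := List.length_eq_zero_iff.1 hn
    refine ⟨(isField_iff_maximalIdeal_eq.2 ?_).isDomain, .nil R R⟩
    rw [← hxs, Ideal.ofList_nil]
  | succ n ih =>
    obtain ⟨x, xs, rfl⟩ := List.exists_cons_of_length_eq_add_one hn
    have hx : x ∈ maximalIdeal R := by
      rw [← hxs, Ideal.ofList_cons]
      exact Ideal.mem_sup_left (Ideal.mem_span_singleton_self x)
    have hspan : Ideal.span {x} = x • (⊤ : Ideal R) := by
      rw [← Submodule.ideal_span_singleton_smul, smul_eq_mul, Ideal.mul_top]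
    let R' := R ⧸ Ideal.span {x}
    have : Nontrivial R' := Ideal.Quotient.nontrivial_iff.2 fun h =>
      (maximalIdeal.isMaximal R).ne_top (top_le_iff.1 (h ▸ (Ideal.span_singleton_le_iff_mem _).2 hx))
    have : IsLocalRing R' := .of_surjective' _ Ideal.Quotient.mk_surjective
    have hmax : Ideal.ofList (xs.map (Ideal.Quotient.mk (Ideal.span {x}))) = maximalIdeal R' := by
      have h1 : (maximalIdeal R).map (Ideal.Quotient.mk (Ideal.span {x})) = maximalIdeal R' :=
        IsLocalRing.map_maximalIdeal_of_surjective _ Ideal.Quotient.mk_surjective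
      rw [← h1, ← hxs, Ideal.map_ofList, List.map_cons, Ideal.ofList_cons,
        Ideal.Quotient.eq_zero_iff_mem.2 (Ideal.mem_span_singleton_self x)]
      simp
    have hlen : xs.length = n := by simpa using hn
    have hdim' : (n : WithBot ℕ∞) ≤ ringKrullDim R' := by
      have h1 := ringKrullDim_le_ringKrullDim_quotSMulTop_succ hx
      rw [← hspan] at h1
      exact WithBot.ENat.le_of_add_one_le ((by exact_mod_cast hdim : (n : WithBot ℕ∞) + 1 ≤ _).trans h1)
    obtain ⟨hdom, hreg⟩ := ih R' (xs.map (Ideal.Quotient.mk (Ideal.span {x})))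
      (by simpa using hlen) hmax hdim'
    have hdimle : ringKrullDim R' ≤ n := by
      refine (ringKrullDim_le_length _ hmax).trans ?_
      simp [hlen]
    have hprime : (Ideal.span {x}).IsPrime := (Ideal.Quotient.isDomain_iff_prime _).1 hdom
    -- The bottom of a chain of primes of length `n + 1`. The plan is to show `p = 0`.
    obtain ⟨p, hp⟩ := exists_prime_le_ringKrullDim_quotient hdim
    rw [← supportDim_quotient_eq_ringKrullDim] at hp hdimle
    have hn' : ¬ (((n + 1 : ℕ) : WithBot ℕ∞) ≤ n) := by
      norm_cast
      omega
    have hxp : x ∉ p.asIdeal := fun hxp => by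
      refine hn' (hp.trans (le_trans (supportDim_le_of_support_subset ?_) hdimle))
      rw [support_quotient_eq_zeroLocus, support_quotient_eq_zeroLocus]
      exact PrimeSpectrum.zeroLocus_anti_mono ((Ideal.span_singleton_le_iff_mem _).2 hxp)
    -- An element `y` of `p` outside the prime `(x)` would be regular on `R/(x)`, so `dim R/(x, y) ≤
    -- n - 1`, whence `dim R/p ≤ dim R/(p, x) + 1 ≤ n`.
    have hle : p.asIdeal ≤ Ideal.span {x} := fun y hy => by
      by_contra hyx
      have h1 := supportDim_quotSMulTop_succ_eq_supportDim
        (isSMulRegular_quotient_of_notMem hprime hyx)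
        (le_maximalIdeal p.2.ne_top hy)
      have h2 := supportDim_le_supportDim_quotSMulTop_succ (M := R ⧸ p.asIdeal) hx
      have h3 : supportDim R (QuotSMulTop x (R ⧸ p.asIdeal)) ≤
          supportDim R (QuotSMulTop y (R ⧸ Ideal.span {x})) := by
        refine supportDim_le_of_support_subset ?_
        rw [support_quotSMulTop, support_quotSMulTop, support_quotient_eq_zeroLocus,
          support_quotient_eq_zeroLocus]
        rintro q ⟨hq, hq'⟩
        exact ⟨by simpa using hq', by simpa using hq hy⟩
      exact hn' (hp.trans (h2.trans (le_trans (by gcongr) (h1.le.trans hdimle))))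
    -- As `p ⊆ (x)` and `x ∉ p`, primality gives `p = x p`, and Nakayama applies.
    have hbot : p.asIdeal = ⊥ := by
      refine Submodule.eq_bot_of_le_smul_of_le_jacobson_bot (Ideal.span {x}) _
        (IsNoetherian.noetherian _) (fun y hy => ?_) ?_
      · obtain ⟨z, rfl⟩ := Ideal.mem_span_singleton'.1 (hle hy)
        rw [mul_comm]
        exact Submodule.smul_mem_smul (Ideal.mem_span_singleton_self x)
          ((p.2.mem_or_mem hy).resolve_right hxp)
      · rw [IsLocalRing.jacobson_eq_maximalIdeal ⊥ bot_ne_top]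
        exact (Ideal.span_singleton_le_iff_mem _).2 hx
    have hR : IsDomain R := by
      have := p.2
      rw [hbot] at this
      exact IsDomain.of_bot_isPrime R
    refine ⟨hR, .cons ?_ ?_⟩
    · rw [hbot, Ideal.mem_bot] at hxp
      exact IsSMulRegular.of_ne_zero hxp
    · have h1 := (isWeaklyRegular_map_algebraMap_iff (R := R) (S := R') R' xs).1 hreg
      exact ((Submodule.quotEquivOfEq _ _ hspan).isWeaklyRegular_congr xs).1 h1

theorem IsRegularLocalRing.exists_isRegular (A : Type u) [CommRing A] [IsRegularLocalRing A] :
    ∃ rs : List A, (rs.length : WithBot ℕ∞) = ringKrullDim A ∧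
      (∀ r ∈ rs, r ∈ maximalIdeal A) ∧ IsRegular A rs := by
  have fg := (maximalIdeal A).fg_of_isNoetherianRing
  have fin := Submodule.FG.finite_generators fg
  let rs := fin.toFinset.toList
  have hlen : (rs.length : WithBot ℕ∞) = ringKrullDim A := by
    rw [Finset.length_toList, ← Set.ncard_eq_toFinset_card _ fin, Submodule.FG.generators_ncard fg]
    exact IsRegularLocalRing.spanFinrank_maximalIdeal
  have hrs : Ideal.ofList rs = maximalIdeal A := by
    have h1 : {r | r ∈ rs} = (maximalIdeal A).generators := by
      ext r
      simp [rs]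
    unfold Ideal.ofList
    rw [h1]
    exact (maximalIdeal A).span_generators
  have hmem : ∀ r ∈ rs, r ∈ maximalIdeal A := fun r hr => hrs ▸ Ideal.subset_span hr
  exact ⟨rs, hlen, hmem, .of_isWeaklyRegular_of_mem_maximalIdeal A hmem
    (isDomain_and_isWeaklyRegular_of_ofList_eq_maximalIdeal rs.length A rs rfl hrs hlen.le).2⟩

end RegularLocalRing

/-! ### Depth is bounded by the dimension at each associated prime -/

section AssociatedPrimes

open IsLocalRing Module RingTheory.Sequence Pointwise

universe v

theorem length_le_ringKrullDim_quotient_of_isAssociatedPrime {A : Type*} [CommRing A]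
    [IsLocalRing A] [IsNoetherianRing A] (rs : List A) (hrs : ∀ r ∈ rs, r ∈ maximalIdeal A)
    (M : Type v) [AddCommGroup M] [Module A M] [Module.Finite A M] (h : IsWeaklyRegular M rs)
    {p : Ideal A} (hp : IsAssociatedPrime p M) :
    (rs.length : WithBot ℕ∞) ≤ ringKrullDim (A ⧸ p) := by
  induction rs generalizing M p with
  | nil =>
    have : Nontrivial (A ⧸ p) := Ideal.Quotient.nontrivial_iff.2 hp.isPrime.ne_top
    exact ringKrullDim_nonneg_of_nontrivial
  | cons x rs ih =>
    rw [isWeaklyRegular_cons_iff] at h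
    obtain ⟨hprime, y, hy⟩ := isAssociatedPrime_iff.1 hp
    have hy0 : y ≠ 0 := by
      rintro rfl
      exact hprime.ne_top (hy.trans (by ext; simp))
    have hxp : x ∉ p := fun hx => by
      rw [hy, Submodule.mem_colon_singleton, Submodule.mem_bot] at hx
      exact hy0 (h.1.right_eq_zero_of_smul hx)
    -- An associated prime `q` of `N/xN` contains both `p` and `x`. Since `x` is regular on `M`, `x
    -- z ∈ N` forces `z ∈ N`, so `N/xN` embeds in `M/xM` and induction applies to `q`; cutting `A/p`
    -- by `x ∉ p` supplies the extra dimension.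
    let N := Submodule.torsionBySet A M (p : Set A)
    have hyN : y ∈ N := by
      rw [Submodule.mem_torsionBySet_iff]
      rintro ⟨a, ha⟩
      rw [SetLike.mem_coe, hy, Submodule.mem_colon_singleton, Submodule.mem_bot] at ha
      exact ha
    have : Nontrivial N := ⟨⟨y, hyN⟩, 0, fun h => hy0 (congrArg Subtype.val h)⟩
    have hx := hrs x List.mem_cons_self
    have : Nontrivial (QuotSMulTop x N) := nontrivial_quotSMulTop_of_mem_maximalIdeal N hx
    obtain ⟨q, hq⟩ := associatedPrimes.nonempty A (QuotSMulTop x N)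
    have hinj : Function.Injective (QuotSMulTop.map x N.subtype) := by
      rw [injective_iff_map_eq_zero]
      intro n hn
      obtain ⟨n, rfl⟩ := Submodule.Quotient.mk_surjective _ n
      rw [QuotSMulTop.map_apply_mk, Submodule.Quotient.mk_eq_zero,
        Submodule.mem_smul_pointwise_iff_exists] at hn
      obtain ⟨z, -, hz⟩ := hn
      have hzN : z ∈ N := by
        rw [Submodule.mem_torsionBySet_iff]
        intro a
        refine h.1.right_eq_zero_of_smul ?_
        rw [smul_comm, hz]
        exact (Submodule.mem_torsionBySet_iff _ _).1 n.2 a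
      rw [Submodule.Quotient.mk_eq_zero, Submodule.mem_smul_pointwise_iff_exists]
      exact ⟨⟨z, hzN⟩, trivial, Subtype.ext hz⟩
    have hqM : IsAssociatedPrime q (QuotSMulTop x M) := hq.map_of_injective _ hinj
    have hann := hq.annihilator_le
    have hpq : p ≤ q := fun a ha => hann <| Submodule.mem_annihilator.2 fun n _ => by
      obtain ⟨n, rfl⟩ := Submodule.Quotient.mk_surjective _ n
      rw [← Submodule.Quotient.mk_smul,
        show a • n = 0 from Subtype.ext ((Submodule.mem_torsionBySet_iff _ _).1 n.2 ⟨a, ha⟩),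
        Submodule.Quotient.mk_zero]
    have hxq : x ∈ q := hann <| Submodule.mem_annihilator.2 fun n _ => by
      obtain ⟨n, rfl⟩ := Submodule.Quotient.mk_surjective _ n
      rw [← Submodule.Quotient.mk_smul, Submodule.Quotient.mk_eq_zero]
      exact Submodule.smul_mem_pointwise_smul _ _ _ trivial
    have hle := ih (fun r hr => hrs r (List.mem_cons_of_mem x hr)) (QuotSMulTop x M) h.2 hqM
    rw [← supportDim_quotient_eq_ringKrullDim] at hle ⊢
    rw [← supportDim_quotSMulTop_succ_eq_supportDim (isSMulRegular_quotient_of_notMem hprime hxp) hx,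
      List.length_cons]
    push_cast
    gcongr
    refine hle.trans (supportDim_le_of_support_subset ?_)
    rw [support_quotSMulTop, support_quotient_eq_zeroLocus, support_quotient_eq_zeroLocus]
    exact fun P hP => ⟨hpq.trans hP, by simpa using hP hxq⟩

end AssociatedPrimes

/-! ### Depth via `Ext`, and its relation to `cmd` and `idealGrade` -/

section Depth

open IsLocalRing Module RingTheory.Sequence CategoryTheory Abelian Pointwise

universe u

theorem ModuleCat.shortExact_of_exact {A : Type u} [CommRing A] {M N P : Type u} [AddCommGroup M]
    [Module A M] [AddCommGroup N] [Module A N] [AddCommGroup P] [Module A P]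
    {f : M →ₗ[A] N} {g : N →ₗ[A] P} (hf : Function.Injective f)
    (hfg : Function.Exact f g) (hg : Function.Surjective g) :
    (ModuleCat.shortComplexOfCompEqZero f g hfg.linearMap_comp_eq_zero).ShortExact :=
  ModuleCat.shortComplex_shortExact _ hfg hf hg

/-- `depth M ≥ n` or `M = 0`, expressed by vanishing of `Ext` from the residue field. -/
def HasDepthGE (A : Type u) [CommRing A] [IsLocalRing A] (M : Type u) [AddCommGroup M] [Module A M]
    (n : ℕ) : Prop :=
  ∀ i < n, Subsingleton (Ext (ModuleCat.of A (A ⧸ maximalIdeal A)) (ModuleCat.of A M) i)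

namespace HasDepthGE

variable {A : Type u} [CommRing A] [IsLocalRing A]
  {M N P : Type u} [AddCommGroup M] [Module A M] [AddCommGroup N] [Module A N]
  [AddCommGroup P] [Module A P]

theorem mono {n n' : ℕ} (h : HasDepthGE A M n) (hn : n' ≤ n) : HasDepthGE A M n' :=
  fun i hi => h i (hi.trans_le hn)

theorem of_subsingleton [Subsingleton M] (n : ℕ) : HasDepthGE A M n := fun i _ => by
  refine ⟨fun x y => ?_⟩
  have h : 𝟙 (ModuleCat.of A M) = 0 := by
    ext m
    exact Subsingleton.elim (α := M) _ _
  rw [← x.comp_mk₀_id, ← y.comp_mk₀_id, h, Ext.mk₀_zero, Ext.comp_zero, Ext.comp_zero]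

/-- Long exact `Ext` sequence. The truncated `n - 1` is harmless, since `n = 0` imposes no
condition. -/
theorem left {f : M →ₗ[A] N} {g : N →ₗ[A] P} (hf : Function.Injective f)
    (hfg : Function.Exact f g) (hg : Function.Surjective g) {n : ℕ} (hN : HasDepthGE A N n)
    (hP : HasDepthGE A P (n - 1)) : HasDepthGE A M n := by
  intro i hi
  have hS := ModuleCat.shortExact_of_exact hf hfg hg
  have := hN i hi
  refine subsingleton_of_forall_eq 0 fun x => ?_
  cases i with
  | zero =>
    have : Mono (ModuleCat.ofHom f) := (ModuleCat.mono_iff_injective _).2 hf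
    obtain ⟨x, rfl⟩ := Ext.homEquiv₀.symm.surjective x
    have h0 : x ≫ ModuleCat.ofHom f = 0 :=
      Ext.homEquiv₀.symm.injective (Subsingleton.elim (α := Ext _ (ModuleCat.of A N) 0) _ _)
    rw [(cancel_mono (ModuleCat.ofHom f)).1 (h0.trans Limits.zero_comp.symm)]
    simp
  | succ i =>
    obtain ⟨y, rfl⟩ := Ext.covariant_sequence_exact₁ _ hS x (Subsingleton.elim _ _) rfl
    have := hP i (by omega)
    rw [Subsingleton.elim y 0, Ext.zero_comp]

theorem right {f : M →ₗ[A] N} {g : N →ₗ[A] P} (hf : Function.Injective f)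
    (hfg : Function.Exact f g) (hg : Function.Surjective g) {n : ℕ} (hM : HasDepthGE A M (n + 1))
    (hN : HasDepthGE A N n) : HasDepthGE A P n := by
  intro i hi
  have hS := ModuleCat.shortExact_of_exact hf hfg hg
  have := hN i hi
  have := hM (i + 1) (by omega)
  refine subsingleton_of_forall_eq 0 fun x => ?_
  obtain ⟨y, rfl⟩ := Ext.covariant_sequence_exact₃ _ hS x rfl (Subsingleton.elim _ _)
  rw [Subsingleton.elim y 0, Ext.zero_comp]

theorem of_linearEquiv (e : M ≃ₗ[A] N) {n : ℕ} (h : HasDepthGE A N n) : HasDepthGE A M n :=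
  left (f := e.toLinearMap) (g := (0 : N →ₗ[A] PUnit.{u + 1})) e.injective
    (fun y => iff_of_true rfl (e.surjective y)) (fun _ => ⟨0, rfl⟩) h (of_subsingleton _)

theorem quotient_ofList_smul_top (rs : List A) (M : Type u) [AddCommGroup M] [Module A M] {n : ℕ}
    (h : HasDepthGE A M (n + rs.length)) (hrs : IsWeaklyRegular M rs) :
    HasDepthGE A (M ⧸ (Ideal.ofList rs • ⊤ : Submodule A M)) n := by
  induction rs generalizing M with
  | nil => exact .of_linearEquiv (Submodule.quotEquivOfEqBot _ (by simp)) h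
  | cons x rs ih =>
    rw [isWeaklyRegular_cons_iff] at hrs
    refine .of_linearEquiv (Submodule.quotOfListConsSMulTopEquivQuotSMulTopInner M x rs)
      (ih _ ?_ hrs.2)
    exact right (f := LinearMap.lsmul A M x) (g := (x • (⊤ : Submodule A M)).mkQ) hrs.1
      (LinearMap.exact_lsmul_mkQ_smul_top M x) (Submodule.mkQ_surjective _) h
      (h.mono (by simp))

theorem maximalIdeal_smul_top_lt [Module.Finite A M] [Nontrivial M] :
    maximalIdeal A • (⊤ : Submodule A M) < ⊤ :=
  (Submodule.top_ne_ideal_smul_of_le_jacobson_annihilator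
    (maximalIdeal_le_jacobson _)).symm.lt_top

variable [IsNoetherianRing A]

theorem of_isWeaklyRegular [Module.Finite A M] {rs : List A} (hrs : ∀ r ∈ rs, r ∈ maximalIdeal A)
    (h : IsWeaklyRegular M rs) : HasDepthGE A M rs.length := by
  nontriviality M using of_subsingleton
  exact ModuleCat.subsingleton_ext_of_exists_isRegular (maximalIdeal A)
    (ModuleCat.of A (A ⧸ maximalIdeal A)) (support_quotient_eq_zeroLocus _).subset
    (ModuleCat.of A M) maximalIdeal_smul_top_lt rs hrs
    (.of_isWeaklyRegular_of_mem_maximalIdeal M hrs h)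

theorem exists_isRegular [Module.Finite A M] [Nontrivial M] {n : ℕ} (h : HasDepthGE A M n) :
    ∃ rs : List A, rs.length = n ∧ (∀ r ∈ rs, r ∈ maximalIdeal A) ∧ IsRegular M rs :=
  ModuleCat.exists_isRegular_of_exists_subsingleton_ext (maximalIdeal A) n (ModuleCat.of A M)
    maximalIdeal_smul_top_lt (ModuleCat.of A (A ⧸ maximalIdeal A))
    (support_quotient_eq_zeroLocus _) h

/-- Tensoring with a flat module preserves weak regularity. -/
theorem pi {ι : Type} [Finite ι] {rs : List A} (hrs : ∀ r ∈ rs, r ∈ maximalIdeal A)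
    (h : IsWeaklyRegular A rs) : HasDepthGE A (ι → A) rs.length :=
  of_isWeaklyRegular hrs <| ((TensorProduct.rid A (ι → A)).isWeaklyRegular_congr rs).1
    (IsWeaklyRegular.isWeaklyRegular_lTensor (M₂ := ι → A) h)

end HasDepthGE

theorem exists_isRegular_length_eq_of_idealGrade_eq {A : Type*} [CommRing A] {I : Ideal A}
    {E : Type*} [AddCommGroup E] [Module A E] [Nontrivial E] {g : ℕ} (hg : idealGrade I E = g) :
    ∃ rs : List A, rs.length = g ∧ (∀ r ∈ rs, r ∈ I) ∧ IsRegular E rs ∧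
      ∀ rs' : List A, (∀ r ∈ rs', r ∈ I) → IsRegular E rs' → rs'.length ≤ g := by
  have hle : ∀ rs' : List A, (∀ r ∈ rs', r ∈ I) → IsRegular E rs' → rs'.length ≤ g :=
    fun rs' h h' => by
      have : (rs'.length : ℕ∞) ≤ g := hg ▸ le_iSup₂_of_le rs' ⟨h', h⟩ le_rfl
      exact_mod_cast this
  -- For `g + 1`, a sequence longer than `g` attains the supremum; for `0` there is no predecessor,
  -- and the empty sequence serves.
  cases g with
  | zero => exact ⟨[], rfl, by simp, .nil A E, hle⟩
  | succ g =>
    have : (g : ℕ∞) < idealGrade I E := by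
      rw [hg]
      exact_mod_cast Nat.lt_succ_self g
    simp only [idealGrade, lt_iSup_iff] at this
    obtain ⟨rs, ⟨h, h'⟩, hlt⟩ := this
    have hlt' : g < rs.length := by exact_mod_cast hlt
    exact ⟨rs, le_antisymm (hle rs h' h) hlt', h', h, hle⟩

/-- The depth is finite, being at most `dim A/p ≤ s` for an associated prime `p` of `M`, so the cast
in `cmd` is faithful. -/
theorem exists_cmd_eq {A : Type u} [CommRing A] [IsLocalRing A] [IsNoetherianRing A]
    {M : Type u} [AddCommGroup M] [Module A M] [Module.Finite A M] {s : ℕ}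
    (hs : supportDim A M = s) :
    ∃ e : ℕ, HasDepthGE A M e ∧ cmd A M = s - e ∧ ∀ n, HasDepthGE A M n → n ≤ e := by
  have : Nontrivial M := (supportDim_ne_bot_iff_nontrivial A M).1 (by simp [hs])
  obtain ⟨p, hp⟩ := associatedPrimes.nonempty A M
  have hps : ringKrullDim (A ⧸ p) ≤ s := by
    rw [← hs, ← supportDim_quotient_eq_ringKrullDim]
    obtain ⟨_, f, hf⟩ := (isAssociatedPrime_iff_exists_injective_linearMap p M).1 hp
    exact supportDim_le_of_injective f hf
  have hle : depth A M ≤ s := iSup₂_le fun rs h => by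
    have := (length_le_ringKrullDim_quotient_of_isAssociatedPrime rs h.2 M h.1.1 hp).trans hps
    exact_mod_cast this
  obtain ⟨e, he⟩ := ENat.ne_top_iff_exists.1 (ne_top_of_le_ne_top (ENat.natCast_ne_top s) hle)
  obtain ⟨rs, hlen, hrs, h, hmax⟩ := exists_isRegular_length_eq_of_idealGrade_eq he.symm
  refine ⟨e, hlen ▸ .of_isWeaklyRegular hrs h.1, ?_, fun n hn => ?_⟩
  · rw [cmd, hs, ← he]
    rfl
  · obtain ⟨rs', rfl, hrs', h'⟩ := hn.exists_isRegular
    exact hmax rs' hrs' h'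

/-- A maximal sequence leaves only zero divisors of `M/(rs)M` in `I`; these form a finite union of
associated primes, so prime avoidance applies. -/
theorem exists_le_isAssociatedPrime_of_maximal {A : Type*} [CommRing A] [IsLocalRing A]
    [IsNoetherianRing A] {I : Ideal A} (hI : I ≠ ⊤) {M : Type*} [AddCommGroup M] [Module A M]
    [Module.Finite A M] [Nontrivial M] {rs : List A} (hrs : ∀ r ∈ rs, r ∈ I) (h : IsRegular M rs)
    (hmax : ∀ rs' : List A, (∀ r ∈ rs', r ∈ I) → IsRegular M rs' → rs'.length ≤ rs.length) :
    ∃ p, I ≤ p ∧ IsAssociatedPrime p (M ⧸ (Ideal.ofList rs • ⊤ : Submodule A M)) := by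
  let Q := M ⧸ (Ideal.ofList rs • ⊤ : Submodule A M)
  have hsub : (I : Set A) ⊆ ⋃ p ∈ associatedPrimes A Q, (p : Set A) := by
    intro x hx
    rw [biUnion_associatedPrimes_eq_zero_divisors]
    by_contra hx'
    have hreg : IsSMulRegular Q x := by
      rw [isSMulRegular_iff_right_eq_zero_of_smul]
      intro y hy
      by_contra hy0
      exact hx' ⟨y, hy0, hy⟩
    have hmem : ∀ r ∈ rs ++ [x], r ∈ I := by
      intro r hr
      rcases List.mem_append.1 hr with hr | hr
      · exact hrs r hr
      · rwa [List.mem_singleton.1 hr]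
    have := hmax (rs ++ [x]) hmem (.of_isWeaklyRegular_of_mem_maximalIdeal M
      (fun r hr => le_maximalIdeal hI (hmem r hr))
      ((isWeaklyRegular_append_iff M rs [x]).2
        ⟨h.1, (isWeaklyRegular_singleton_iff Q x).2 hreg⟩))
    simp at this
  obtain ⟨p, hp, hIp⟩ := (I.subset_union_prime_finite (associatedPrimes.finite A Q) (f := id) 0 0
    fun _ h _ _ => h.1).1 hsub
  exact ⟨p, hIp, hp⟩

end Depth

/-! ### Dimensions of Koszul homology and the depth count -/

section CohenMacaulayDefect

open IsLocalRing Module RingTheory.Sequence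

universe u

namespace Koszul

variable {A : Type u} [CommRing A] {m : ℕ}

theorem supportDim_H_eq [IsNoetherianRing A] (u : Fin m → A) {rs : List A}
    (hrs : ∀ r ∈ rs, r ∈ Ideal.span (Set.range u)) (hm : rs.length ≤ m) (h : IsWeaklyRegular A rs)
    {p : Ideal A} (hu : Ideal.span (Set.range u) ≤ p)
    (hp : IsAssociatedPrime p (A ⧸ (Ideal.ofList rs • ⊤ : Submodule A A)))
    (hdim : supportDim A (A ⧸ (Ideal.ofList rs • ⊤ : Submodule A A)) ≤ ringKrullDim (A ⧸ p))
    {i : ℕ} (hi : i ≤ m - rs.length) :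
    supportDim A (H u i) = supportDim A (A ⧸ (Ideal.ofList rs • ⊤ : Submodule A A)) := by
  refine le_antisymm (supportDim_le_of_support_subset fun q hq => ?_) (hdim.trans ?_)
  · have hq' := (le_annihilator_H u i).trans (annihilator_le_of_mem_support hq)
    rw [smul_eq_mul, Ideal.mul_top, support_quotient_eq_zeroLocus]
    exact (Ideal.span_le.2 hrs).trans hq'
  · rw [← supportDim_quotient_eq_ringKrullDim]
    refine supportDim_le_of_support_subset fun q hq => ?_
    rw [support_quotient_eq_zeroLocus] at hq
    exact mem_support_mono (p := ⟨p, hp.isPrime⟩) hq <|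
      mem_support_H_of_isAssociatedPrime u rs hrs hm h _
        (fun j => hu (Ideal.subset_span ⟨j, rfl⟩)) hp hi

theorem exact_inclusion_mkQ (u : Fin m → A) (i : ℕ) :
    Function.Exact (Submodule.inclusion (boundaries_le_cycles u i))
      ((boundaries u i).submoduleOf (cycles u i)).mkQ := fun z => by
  rw [Submodule.mkQ_apply, Submodule.Quotient.mk_eq_zero]
  exact ⟨fun hz => ⟨⟨z.1, hz⟩, rfl⟩, by rintro ⟨b, rfl⟩; exact b.2⟩

theorem exact_subtype_rangeRestrict (u : Fin m → A) (i : ℕ) :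
    Function.Exact (cycles u (i + 1)).subtype (d u i).rangeRestrict := fun f => by
  rw [← LinearMap.mem_ker, LinearMap.ker_rangeRestrict]
  exact ⟨fun hf => ⟨⟨f, hf⟩, rfl⟩, by rintro ⟨b, rfl⟩; exact b.2⟩

variable [IsLocalRing A]

theorem hasDepthGE_boundaries_of_hasDepthGE_cycles (u : Fin m → A) {i n : ℕ}
    (hZ : HasDepthGE A (cycles u i) n) (hH : HasDepthGE A (H u i) (n - 1)) :
    HasDepthGE A (boundaries u i) n :=
  .left (Submodule.inclusion_injective _) (exact_inclusion_mkQ u i) (Submodule.mkQ_surjective _)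
    hZ hH

theorem hasDepthGE_H (u : Fin m → A) {i n : ℕ}
    (hB : HasDepthGE A (boundaries u i) (n + 1)) (hZ : HasDepthGE A (cycles u i) n) :
    HasDepthGE A (H u i) n :=
  .right (Submodule.inclusion_injective _) (exact_inclusion_mkQ u i) (Submodule.mkQ_surjective _)
    hB hZ

theorem hasDepthGE_cycles_succ (u : Fin m → A) {i n : ℕ}
    (hK : HasDepthGE A (Chain A m (i + 1)) n) (hB : HasDepthGE A (boundaries u i) (n - 1)) :
    HasDepthGE A (cycles u (i + 1)) n :=
  .left (Submodule.subtype_injective _) (exact_subtype_rangeRestrict u i)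
    (LinearMap.surjective_rangeRestrict _) hK hB

theorem hasDepthGE_boundaries_of_hasDepthGE_cycles_succ (u : Fin m → A) {i n : ℕ}
    (hZ : HasDepthGE A (cycles u (i + 1)) (n + 1)) (hK : HasDepthGE A (Chain A m (i + 1)) n) :
    HasDepthGE A (boundaries u i) n :=
  .right (Submodule.subtype_injective _) (exact_subtype_rangeRestrict u i)
    (LinearMap.surjective_rangeRestrict _) hZ hK

/-- If the Koszul complex is exact in degrees greater than `m - g`, then the module of boundaries
in degree `m - j`, `j ≤ g`, has a free resolution of length `j - 1`. -/
theorem hasDepthGE_boundaries_of_cycles_le_boundaries (u : Fin m → A) {n g : ℕ}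
    (hK : ∀ i, HasDepthGE A (Chain A m i) n) (hgm : g ≤ m) (hgn : g ≤ n)
    (hex : ∀ i, m < i + g → cycles u i ≤ boundaries u i) {j : ℕ} (hj : j ≤ g) :
    HasDepthGE A (boundaries u (m - j)) (n + 1 - j) := by
  induction j with
  -- There are no chains of degree `m + 1`, so the top boundaries vanish and satisfy even the bound
  -- `n + 1`.
  | zero =>
    have : Subsingleton (Chain A m (m + 1)) := by
      refine ⟨fun f f' => funext fun T => ?_⟩
      have := Finset.card_le_univ T.1
      rw [T.2, Fintype.card_fin] at this
      omega
    have : Subsingleton (boundaries u (m - 0)) :=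
      (LinearMap.surjective_rangeRestrict (d u m)).subsingleton
    exact .of_subsingleton _
  | succ j ih =>
    have hi : m - j = m - (j + 1) + 1 := by omega
    have hZB := le_antisymm (hex (m - j) (by omega)) (boundaries_le_cycles u (m - j))
    have h := ih (by omega)
    rw [← hZB, hi, show n + 1 - j = n + 1 - (j + 1) + 1 by omega] at h
    exact hasDepthGE_boundaries_of_hasDepthGE_cycles_succ u h ((hK _).mono (by omega))

/-- One unit of depth is gained from `H_i` to `B_i` and another from `B_i` to `Z_{i+1}`; this is the
source of the `2` in the theorem. -/
theorem hasDepthGE_cycles (u : Fin m → A) {n e k : ℕ}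
    (hK : ∀ i, HasDepthGE A (Chain A m i) n) (hH : ∀ i < k, HasDepthGE A (H u i) e) {i : ℕ}
    (hi : i ≤ k) : HasDepthGE A (cycles u i) (min n (e + 2)) := by
  induction i with
  | zero =>
    exact .of_linearEquiv (N := Chain A m 0) Submodule.topEquiv ((hK 0).mono (min_le_left _ _))
  | succ i ih =>
    refine hasDepthGE_cycles_succ u ((hK _).mono (min_le_left _ _)) ?_
    refine hasDepthGE_boundaries_of_hasDepthGE_cycles u ((ih (by omega)).mono (Nat.sub_le _ _))
      ((hH i hi).mono (by omega))

end Koszul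

end CohenMacaulayDefect

end

/-- `u` is a minimal system of generators of the proper ideal `I`, so `H_i(I) = H_i(u)`.
The maximum `c` is the supremum in `ℤ` of a finite family; if `m = g` the family is empty and its
supremum is `0`. -/
theorem theorem1p9 {A : Type*} [CommRing A] [IsRegularLocalRing A]
    (I : Ideal A) (hI : I ≠ ⊤)
    (m : ℕ) (hm : m = I.spanFinrank)
    (u : Fin m → A) (hu : Ideal.span (Set.range u) = I)
    (g : ℕ) (hg : idealGrade I A = g)
    (c : ℤ) (hc : c = ⨆ i : Fin (m - g), cmd A (Koszul.H u i)) :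
    cmd A (Koszul.H u (m - g)) ≤ max 0 (c - 2) := by
  obtain ⟨as, hdim, has, hreg⟩ := IsRegularLocalRing.exists_isRegular A
  have hK : ∀ i, HasDepthGE A (Koszul.Chain A m i) as.length := fun i => .pi has hreg.1
  have hA : HasDepthGE A A as.length := .of_isWeaklyRegular has hreg.1
  obtain ⟨rs, rfl, hrs, h, hmax⟩ := exists_isRegular_length_eq_of_idealGrade_eq hg
  obtain ⟨p, hIp, hp⟩ := exists_le_isAssociatedPrime_of_maximal hI hrs h hmax
  have hQ := Module.supportDim_add_length_eq_supportDim_of_isRegular rs h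
  rw [Module.supportDim_self_eq_ringKrullDim, ← hdim] at hQ
  have hQnt := h.quot_ofList_smul_nontrivial ⊤
  obtain ⟨s, hs⟩ : ∃ s : ℕ,
      Module.supportDim A (A ⧸ (Ideal.ofList rs • ⊤ : Submodule A A)) = s := by
    have hne := Module.supportDim_ne_bot_of_nontrivial A
      (A ⧸ (Ideal.ofList rs • ⊤ : Submodule A A))
    generalize Module.supportDim A (A ⧸ (Ideal.ofList rs • ⊤ : Submodule A A)) = x at hQ hne
    induction x with
    | bot => exact absurd rfl hne
    | coe x =>
      induction x with
      | top => norm_cast at hQ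
      | coe x => exact ⟨x, rfl⟩
  rw [hs] at hQ
  have hsg : s + rs.length = as.length := by exact_mod_cast hQ
  -- `A/(rs)` has depth at least `dim A - g = s`, and depth bounds `dim A/p` from below at every
  -- associated prime.
  have hpdim : (s : WithBot ℕ∞) ≤ ringKrullDim (A ⧸ p) := by
    obtain ⟨ts, rfl, hts, ht⟩ := (HasDepthGE.quotient_ofList_smul_top (n := s) rs A
      (hsg ▸ hA) h.1).exists_isRegular
    exact length_le_ringKrullDim_quotient_of_isAssociatedPrime ts hts _ ht.1 hp
  -- `dim A ≤ dim A/I + m` and `dim A/I ≤ dim A/(rs) = dim A - g`.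
  have hgm : rs.length ≤ m := by
    have h1 := ringKrullDim_le_ringKrullDim_quotient_add_spanFinrank (I := I)
      (by rw [IsLocalRing.ringJacobson_eq_maximalIdeal]; exact IsLocalRing.le_maximalIdeal hI)
    have h2 : ringKrullDim (A ⧸ I) ≤ s := by
      rw [← hs, ← Module.supportDim_quotient_eq_ringKrullDim]
      refine supportDim_le_of_support_subset ?_
      rw [smul_eq_mul, Ideal.mul_top, support_quotient_eq_zeroLocus, support_quotient_eq_zeroLocus]
      exact PrimeSpectrum.zeroLocus_anti_mono (Ideal.span_le.2 hrs)
    rw [← hdim, ← hm] at h1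
    have h3 : (as.length : WithBot ℕ∞) ≤ s + m := h1.trans (by gcongr)
    have h4 : as.length ≤ s + m := by exact_mod_cast h3
    omega
  subst hu
  have hsupp : ∀ i ≤ m - rs.length, Module.supportDim A (Koszul.H u i) = s := fun i hi =>
    (Koszul.supportDim_H_eq u hrs hgm h.1 hIp hp (hs.le.trans hpdim) hi).trans hs
  -- `toNat` truncates to `0` when `c > s`, where the final bound `max 0 (s - 2)` is still at most
  -- `max 0 (c - 2)`.
  have hH : ∀ i < m - rs.length, HasDepthGE A (Koszul.H u i) (s - c).toNat := fun i hi => by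
    obtain ⟨e, he, hcmd, -⟩ := exists_cmd_eq (hsupp i hi.le)
    have : cmd A (Koszul.H u i) ≤ c := hc ▸ le_ciSup
      (f := fun i : Fin (m - rs.length) => cmd A (Koszul.H u i)) (Set.finite_range _).bddAbove ⟨i, hi⟩
    exact he.mono (by omega)
  have hB := Koszul.hasDepthGE_boundaries_of_cycles_le_boundaries u hK hgm (by omega)
    (fun i hi => Koszul.cycles_le_boundaries_of_isWeaklyRegular u rs hrs h.1 hi) le_rfl
  have hZ := Koszul.hasDepthGE_cycles u hK hH le_rfl
  obtain ⟨e, -, hcmd, hmaxe⟩ := exists_cmd_eq (hsupp _ le_rfl)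
  -- The boundaries contribute `(n + 1 - g) - 1 = s`, the cycles `min n (e + 2)` with `n ≥ s`.
  have := hmaxe _ (Koszul.hasDepthGE_H u (n := min s ((s - c).toNat + 2))
    (hB.mono (by omega)) (hZ.mono (by omega)))
  omega
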